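/- Let $A=\begin{pmatrix}1&1\\0&1\end{pmatrix}$ and $B=\begin{pmatrix}1&0\\-1&1\end{pmatrix}$, regarded as elements of $\mathrm{PSL}(2,\mathbb Z)$, and for $l\in\mathbb N$ let $B(l)\subset\mathrm{PSL}(2,\mathbb Z)$ be the set of vertices of the ball of radius $l$ centred at $1$ in the Cayley graph of $\mathrm{PSL}(2,\mathbb Z)$ with generators $A^{\pm1},B^{\pm1}$. Let $X$ be the Farey graph: its vertex set is $\mathbb Q\cup\{\infty\}$ (with $\infty=\frac10$), and two reduced fractions $\frac pq,\frac rs$ are adjacent if and only if $|ps-qr|=1$; the group $\mathrm{PSL}(2,\mathbb Z)$ acts on $X$ by Möbius transformations. Let $P=\frac01$. An element $g$ acts loxodromically on $X$ if $\lim_{n\to\infty}\frac1n d_X(P,g^n.P)$ exists and is positive. A geodesic axis of such a $g$ is a bi-infinite geodesic in $X$ joining the two limit points at infinity of the orbit $(g^n.P)_{n\in\mathbb Z}$, that is, lying at finite Hausdorff distance from this orbit. We say that the axis of $g$ passes within distance $1$ of $P$ if $g$ has a geodesic axis on which it acts as a translation, and every geodesic axis of $g$ contains a vertex at distance at most $1$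 from $P$. Then $$\liminf_{l\to\infty}\frac{\#\{g\in B(l)\;:\; g\text{ acts loxodromically on }X\text{ and its axis passes within distance }1\text{ of }P\}}{\#B(l)}>0.$$ -/

import Mathlib

open Filter Topology
open scoped MatrixGroups

namespace FareyPSL

/-! ### Isometries of graphs: loxodromic actions and axes -/

section Dynamics

variable {V : Type*}

/-- The vertex permutation `φ` acts loxodromically on the graph `X` with base vertex `P`:
the limit of `d(P, φⁿ P) / n` exists and is positive. -/
def ActsLoxodromically (X : SimpleGraph V) (φ : Equiv.Perm V) (P : V) : Prop :=
  ∃ τ : ℝ, 0 < τ ∧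
    Tendsto (fun n : ℕ => (X.dist P ((φ ^ n) P) : ℝ) / (n : ℝ)) atTop (𝓝 τ)

/-- A bi-infinite geodesic of `X`, recorded by the sequence of its vertices. -/
def IsBiinfiniteGeodesic (X : SimpleGraph V) (γ : ℤ → V) : Prop :=
  ∀ m n : ℤ, X.dist (γ m) (γ n) = (m - n).natAbs

/-- `γ` is a geodesic axis of `φ`: a bi-infinite geodesic which connects the two limit points of
the orbit of `P` under the powers of `φ`, i.e. which is at finite Hausdorff distance from that
orbit. -/
def IsGeodesicAxis (X : SimpleGraph V) (φ : Equiv.Perm V) (P : V) (γ : ℤ → V) : Prop :=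
  IsBiinfiniteGeodesic X γ ∧
    ∃ C : ℕ, (∀ n : ℤ, ∃ m : ℤ, X.dist (γ m) ((φ ^ n) P) ≤ C) ∧
      ∀ m : ℤ, ∃ n : ℤ, X.dist (γ m) ((φ ^ n) P) ≤ C

/-- `φ` acts on the line `γ` as a translation. -/
def TranslatesLine (φ : Equiv.Perm V) (γ : ℤ → V) : Prop :=
  ∃ k : ℤ, ∀ n : ℤ, φ (γ n) = γ (n + k)

/-- The axis of `φ` passes within distance `r` of `P`: `φ` translates some geodesic axis, and
every geodesic axis of `φ` has a vertex at distance at most `r` from `P`. -/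
def AxisPassesWithin (X : SimpleGraph V) (φ : Equiv.Perm V) (P : V) (r : ℕ) : Prop :=
  (∃ γ : ℤ → V, IsGeodesicAxis X φ P γ ∧ TranslatesLine φ γ) ∧
    ∀ γ : ℤ → V, IsGeodesicAxis X φ P γ → ∃ n : ℤ, X.dist P (γ n) ≤ r

end Dynamics

/-! ### The Farey graph -/

/-- Numerator of a reduced fraction in `ℚ ∪ {∞}`, where `∞ = 1/0`. -/
def num (x : OnePoint ℚ) : ℤ := x.elim 1 (fun q => q.num)

/-- Denominator of a reduced fraction in `ℚ ∪ {∞}`, where `∞ = 1/0`. -/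
def den (x : OnePoint ℚ) : ℤ := x.elim 0 (fun q => (q.den : ℤ))

/-- The Farey graph: the vertices are `ℚ ∪ {∞}`, and reduced fractions `p/q` and `r/s` are joined
by an edge if and only if `|p s - q r| = 1`. -/
def fareyGraph : SimpleGraph (OnePoint ℚ) where
  Adj x y := |num x * den y - den x * num y| = 1
  symm := ⟨fun x y h => by
    rw [← h, ← abs_neg]
    congr 1
    ring⟩
  loopless := ⟨fun x h => by
    rw [show num x * den x - den x * num x = 0 by ring] at h
    simp at h⟩

/-- The vertex `0/1` of the Farey graph. -/
def zeroVertex : OnePoint ℚ := ((0 : ℚ) : OnePoint ℚ)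

/-! ### `PSL(2, ℤ)` and its action by Möbius transformations -/

/-- `SL(2, ℤ)` acting on `ℚ ∪ {∞}` by `x ↦ (a x + b) / (c x + d)`. -/
noncomputable def slAction : SL(2, ℤ) →* Equiv.Perm (OnePoint ℚ) :=
  (MulAction.toPermHom (GL (Fin 2) ℚ) (OnePoint ℚ)).comp (Matrix.SpecialLinearGroup.mapGL ℚ)

theorem slAction_eq_one_of_mem_center (g : SL(2, ℤ)) (hg : g ∈ Subgroup.center SL(2, ℤ)) :
    slAction g = 1 := by
  obtain ⟨r, hr, hg⟩ := Matrix.SpecialLinearGroup.mem_center_iff.mp hg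
  rw [Matrix.scalar_apply] at hg
  have h00 : g 0 0 = r := by rw [← hg]; simp
  have h01 : g 0 1 = 0 := by rw [← hg]; simp
  have h10 : g 1 0 = 0 := by rw [← hg]; simp
  have h11 : g 1 1 = r := by rw [← hg]; simp
  have hr0 : (r : ℚ) ≠ 0 := by
    rintro h
    have : r = 0 := by exact_mod_cast h
    simp [this] at hr
  ext x : 1
  change Matrix.SpecialLinearGroup.mapGL ℚ g • x = x
  cases x with
  | infty => simp [OnePoint.smul_infty_eq_ite, h10]
  | coe q => simp [OnePoint.smul_some_eq_ite, h00, h01, h10, h11, hr0]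

/-- The induced action of `PSL(2, ℤ)` on the vertices of the Farey graph. -/
noncomputable def pslAction : PSL(2, ℤ) →* Equiv.Perm (OnePoint ℚ) :=
  QuotientGroup.lift (Subgroup.center SL(2, ℤ)) slAction slAction_eq_one_of_mem_center

/-- The matrix `A` with rows `(1, 1)` and `(0, 1)`. -/
def matA : SL(2, ℤ) := ⟨!![1, 1; 0, 1], by simp [Matrix.det_fin_two]⟩

/-- The matrix `B` with rows `(1, 0)` and `(-1, 1)`. -/
def matB : SL(2, ℤ) := ⟨!![1, 0; -1, 1], by simp [Matrix.det_fin_two]⟩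

/-- The class of the matrix `A` in `PSL(2, ℤ)`. -/
def A : PSL(2, ℤ) := QuotientGroup.mk matA

/-- The class of the matrix `B` in `PSL(2, ℤ)`. -/
def B : PSL(2, ℤ) := QuotientGroup.mk matB

/-- The ball of radius `l` centred at `1` in the Cayley graph of `PSL(2, ℤ)` with respect to the
generators `A`, `A⁻¹`, `B`, `B⁻¹`. -/
def cayleyBall (l : ℕ) : Set PSL(2, ℤ) :=
  {g | (SimpleGraph.mulCayley ({A, A⁻¹, B, B⁻¹} : Set PSL(2, ℤ))).edist 1 g ≤ (l : ℕ∞)}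

/-- The elements of the ball of radius `l` that act loxodromically on the Farey graph and whose
axis passes within distance `1` of the vertex `0/1`. -/
def loxodromicInBall (l : ℕ) : Set PSL(2, ℤ) :=
  {g ∈ cayleyBall l | ActsLoxodromically fareyGraph (pslAction g) zeroVertex ∧
    AxisPassesWithin fareyGraph (pslAction g) zeroVertex 1}

end FareyPSL

/-!
In the coordinate `1 / x` the vertex `0` is the point at infinity, and a Farey edge that avoids `0`
cannot jump over an integer `k`. Hence a geodesic from a vertex with `1 / x ≤ 0` to a vertex with
`1 / y ≥ 2` passes through `0`, or else through both `∞` and `1 / 2`; these two vertices are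
neighbours of `0` at distance `2` from each other, so in both cases `0` lies between the endpoints.
If `g` maps `[0, ∞]` into `(0, 1 / 2]`, then the forward orbit of `0` stays in `[0, ∞]` and the
backward orbit in `[∞, 0]`, so the distances along the orbit add up: `g` translates a geodesic line
through `0`. The ball of radius `1` about `0` contains `0` and `∞` and therefore separates the two
halves of the orbit, which forces every axis of `g` to meet it.

Multiplying an arbitrary matrix on each side by the identity or by the rotation `x ↦ -1 / x` makes
all its entries of one sign, and then `B⁻² m A` maps `[0, ∞]` into `(0, 1 / 2]`. So every element of
the group acquires this property after multiplication by words of bounded length, and in balls of a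
finitely generated group the elements with such a property have positive proportion.
-/

namespace FareyPSL

section Graphs

variable {V W : Type*} {X : SimpleGraph V} {Y : SimpleGraph W}

theorem dist_map_le (f : X →g Y) {x y : V} (h : X.Reachable x y) :
    Y.dist (f x) (f y) ≤ X.dist x y := by
  obtain ⟨w, hw⟩ := h.exists_walk_length_eq_dist
  simpa [← hw] using SimpleGraph.dist_le (w.map f)

theorem dist_iso_apply (f : X ≃g Y) (x y : V) : Y.dist (f x) (f y) = X.dist x y := by
  by_cases h : X.Reachable x y
  · refine (dist_map_le f.toHom h).antisymm ?_
    simpa using dist_map_le f.symm.toHom (f.reachable_iff.mpr h)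
  · rw [SimpleGraph.dist_eq_zero_of_not_reachable h,
      SimpleGraph.dist_eq_zero_of_not_reachable (mt f.reachable_iff.mp h)]

theorem dist_add_dist_le_length {x y z : V} (w : X.Walk x y) (hz : z ∈ w.support) :
    X.dist x z + X.dist z y ≤ w.length := by
  classical
  calc X.dist x z + X.dist z y
      ≤ (w.takeUntil z hz).length + (w.dropUntil z hz).length :=
        add_le_add (SimpleGraph.dist_le _) (SimpleGraph.dist_le _)
    _ = w.length := by rw [← SimpleGraph.Walk.length_append, w.take_spec hz]

theorem dist_le_natAbs_of_dist_succ_le_one (hX : X.Connected) {γ : ℤ → V}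
    (h : ∀ m, X.dist (γ m) (γ (m + 1)) ≤ 1) (m n : ℤ) :
    X.dist (γ m) (γ n) ≤ (m - n).natAbs := by
  wlog hmn : m ≤ n generalizing m n
  · rw [SimpleGraph.dist_comm, ← Int.natAbs_neg, neg_sub]
    exact this n m (by omega)
  induction n, hmn using Int.leInduction with
  | base => simp
  | succ n hmn ih =>
    have htri := hX.dist_triangle (u := γ m) (v := γ n) (w := γ (n + 1))
    have hstep := h n
    omega

theorem isBiinfiniteGeodesic_of_dist_succ_le_one (hX : X.Connected) {γ : ℤ → V}
    (h : ∀ m, X.dist (γ m) (γ (m + 1)) ≤ 1)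
    (hcofinal : ∀ k : ℕ, ∃ a b : ℤ, a ≤ -k ∧ k ≤ b ∧ X.dist (γ a) (γ b) = (a - b).natAbs) :
    IsBiinfiniteGeodesic X γ := by
  intro m n
  wlog hmn : m ≤ n generalizing m n
  · rw [SimpleGraph.dist_comm, this n m (by omega), ← Int.natAbs_neg, neg_sub]
  obtain ⟨a, b, ha, hb, hab⟩ := hcofinal (m.natAbs + n.natAbs)
  have hle := dist_le_natAbs_of_dist_succ_le_one hX h
  have ham := hle a m
  have hmn' := hle m n
  have hnb := hle n b
  have htri₁ := hX.dist_triangle (u := γ a) (v := γ m) (w := γ b)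
  have htri₂ := hX.dist_triangle (u := γ m) (v := γ n) (w := γ b)
  omega

end Graphs

section AlignedOrbits

variable {V : Type*} {X : SimpleGraph V} {φ : Equiv.Perm V} {P : V}

theorem dist_zpow_apply (hφ : ∀ x y, X.dist (φ x) (φ y) = X.dist x y) (k : ℤ) (x y : V) :
    X.dist ((φ ^ k) x) ((φ ^ k) y) = X.dist x y := by
  induction k generalizing x y with
  | zero => simp
  | succ k ih => rw [zpow_add_one, Equiv.Perm.mul_apply, Equiv.Perm.mul_apply, ih, hφ]
  | pred k ih =>
    rw [zpow_sub_one, Equiv.Perm.mul_apply, Equiv.Perm.mul_apply, ih, ← hφ]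
    simp

/-- The iterates `P, φ P, φ² P, …` lie in this order, equally spaced, along a geodesic ray. -/
def HasAlignedOrbit (X : SimpleGraph V) (φ : Equiv.Perm V) (P : V) : Prop :=
  ∀ n : ℕ, X.dist P ((φ ^ n) P) = n * X.dist P (φ P)

theorem hasAlignedOrbit_of_dist_eq_add (hφ : ∀ x y, X.dist (φ x) (φ y) = X.dist x y)
    (h : ∀ n : ℕ, X.dist ((φ⁻¹ ^ n) P) (φ P) = X.dist ((φ⁻¹ ^ n) P) P + X.dist P (φ P)) :
    HasAlignedOrbit X φ P := by
  have hshift (n : ℕ) (x : V) : X.dist ((φ⁻¹ ^ n) P) x = X.dist P ((φ ^ n) x) := by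
    rw [← dist_zpow_apply hφ n, zpow_natCast, ← Equiv.Perm.mul_apply, inv_pow, mul_inv_cancel,
      Equiv.Perm.one_apply]
  intro n
  induction n with
  | zero => simp
  | succ n ih =>
    rw [pow_succ, Equiv.Perm.mul_apply, ← hshift, h, hshift, ih, add_one_mul]

theorem HasAlignedOrbit.dist_zpow_zpow (hP : HasAlignedOrbit X φ P)
    (hφ : ∀ x y, X.dist (φ x) (φ y) = X.dist x y) (a b : ℤ) :
    X.dist ((φ ^ a) P) ((φ ^ b) P) = (a - b).natAbs * X.dist P (φ P) := by
  wlog h : a ≤ b generalizing a b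
  · rw [SimpleGraph.dist_comm, this b a (by omega), ← Int.natAbs_neg, neg_sub]
  obtain ⟨n, rfl⟩ := Int.le.dest h
  rw [zpow_add, Equiv.Perm.mul_apply, dist_zpow_apply hφ, zpow_natCast, hP, sub_add_cancel_left,
    Int.natAbs_neg, Int.natAbs_natCast]

theorem HasAlignedOrbit.actsLoxodromically (hP : HasAlignedOrbit X φ P)
    (hpos : 0 < X.dist P (φ P)) : ActsLoxodromically X φ P := by
  refine ⟨X.dist P (φ P), mod_cast hpos, tendsto_const_nhds.congr' ?_⟩
  filter_upwards [eventually_ne_atTop 0] with n hn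
  rw [hP, Nat.cast_mul, mul_div_cancel_left₀ _ (Nat.cast_ne_zero.mpr hn)]

/-- The bi-infinite line traced by the translates `φ^q w` of a walk `w` from `P` to `φ P`. -/
def translatesOfWalk (φ : Equiv.Perm V) {P : V} (w : X.Walk P (φ P)) (m : ℤ) : V :=
  (φ ^ (m / w.length)) (w.getVert (m % w.length).toNat)

theorem translatesOfWalk_add_mul {w : X.Walk P (φ P)} (hw : 0 < w.length) (m q : ℤ) :
    translatesOfWalk φ w (m + q * w.length) = (φ ^ q) (translatesOfWalk φ w m) := by
  have hw' : (w.length : ℤ) ≠ 0 := by omega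
  rw [translatesOfWalk, Int.add_mul_ediv_right _ _ hw', Int.add_mul_emod_self_right, add_comm,
    zpow_add, Equiv.Perm.mul_apply, translatesOfWalk]

theorem translatesOfWalk_natCast {w : X.Walk P (φ P)} (hw : 0 < w.length) {r : ℕ}
    (hr : r ≤ w.length) : translatesOfWalk φ w r = w.getVert r := by
  rcases hr.lt_or_eq with hr | rfl
  · have hr' : (r : ℤ) < w.length := mod_cast hr
    simp [translatesOfWalk, Int.ediv_eq_zero_of_lt (Int.natCast_nonneg r) hr',
      Int.emod_eq_of_lt (Int.natCast_nonneg r) hr']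
  · have h := translatesOfWalk_add_mul hw 0 1
    simpa [translatesOfWalk] using h

theorem translatesOfWalk_mul {w : X.Walk P (φ P)} (hw : 0 < w.length) (q : ℤ) :
    translatesOfWalk φ w (q * w.length) = (φ ^ q) P := by
  have h0 : translatesOfWalk φ w 0 = P := by simp [translatesOfWalk]
  rw [← zero_add (q * (w.length : ℤ)), translatesOfWalk_add_mul hw, h0]

theorem dist_translatesOfWalk_succ (hφ : ∀ x y, X.dist (φ x) (φ y) = X.dist x y)
    {w : X.Walk P (φ P)} (hw : 0 < w.length) (m : ℤ) :
    X.dist (translatesOfWalk φ w m) (translatesOfWalk φ w (m + 1)) = 1 := by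
  obtain ⟨q, r, hr, rfl⟩ : ∃ (q : ℤ) (r : ℕ), r < w.length ∧ m = r + q * w.length := by
    have hw' : (0 : ℤ) < w.length := mod_cast hw
    have hnonneg := Int.emod_nonneg m hw'.ne'
    have hlt := Int.emod_lt_of_pos m hw'
    refine ⟨m / w.length, (m % w.length).toNat, by omega, ?_⟩
    rw [Int.toNat_of_nonneg hnonneg, Int.emod_add_ediv_mul]
  have hsucc : (r + q * w.length + 1 : ℤ) = (r + 1 : ℕ) + q * w.length := by push_cast; ring
  rw [hsucc, translatesOfWalk_add_mul hw, translatesOfWalk_add_mul hw, dist_zpow_apply hφ,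
    translatesOfWalk_natCast hw hr.le, translatesOfWalk_natCast hw hr,
    SimpleGraph.dist_eq_one_iff_adj]
  exact w.adj_getVert_succ hr

theorem HasAlignedOrbit.isBiinfiniteGeodesic_translatesOfWalk (hP : HasAlignedOrbit X φ P)
    (hX : X.Connected) (hφ : ∀ x y, X.dist (φ x) (φ y) = X.dist x y) {w : X.Walk P (φ P)}
    (hpos : 0 < w.length) (hw : w.length = X.dist P (φ P)) :
    IsBiinfiniteGeodesic X (translatesOfWalk φ w) := by
  refine isBiinfiniteGeodesic_of_dist_succ_le_one hX
    (fun m => (dist_translatesOfWalk_succ hφ hpos m).le)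
    fun k => ⟨-k * w.length, k * w.length, ?_, ?_, ?_⟩
  · nlinarith
  · nlinarith
  · rw [translatesOfWalk_mul hpos, translatesOfWalk_mul hpos, hP.dist_zpow_zpow hφ, ← hw,
      ← sub_mul, Int.natAbs_mul, Int.natAbs_natCast]

theorem HasAlignedOrbit.exists_isGeodesicAxis_translatesLine (hP : HasAlignedOrbit X φ P)
    (hX : X.Connected) (hφ : ∀ x y, X.dist (φ x) (φ y) = X.dist x y)
    (hpos : 0 < X.dist P (φ P)) : ∃ γ : ℤ → V, IsGeodesicAxis X φ P γ ∧ TranslatesLine φ γ := by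
  obtain ⟨w, hw⟩ := hX.exists_walk_length_eq_dist P (φ P)
  have hw0 : 0 < w.length := hw ▸ hpos
  have hgeod := hP.isBiinfiniteGeodesic_translatesOfWalk hX hφ hw0 hw
  refine ⟨translatesOfWalk φ w, ⟨hgeod, w.length, fun n => ⟨n * w.length, ?_⟩,
    fun m => ⟨m / w.length, ?_⟩⟩, w.length, fun n => ?_⟩
  · simp [translatesOfWalk_mul hw0]
  · rw [← translatesOfWalk_mul hw0, hgeod]
    have hdiv := Int.emod_add_ediv_mul m w.length
    have hlt := Int.emod_lt_of_pos m (mod_cast hw0 : (0 : ℤ) < w.length)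
    have hnonneg := Int.emod_nonneg m (mod_cast hw0.ne' : (w.length : ℤ) ≠ 0)
    omega
  · simpa using (translatesOfWalk_add_mul hw0 n 1).symm

end AlignedOrbits

section Separation

variable {V : Type*} {X : SimpleGraph V} {φ : Equiv.Perm V} {P : V} {r : ℕ} {L R : Set V}

/-- The ball of radius `r` about `P` separates `L` from `R`: it meets every walk from a vertex of
`L` to a vertex of `R`. The sets `L` and `R` may themselves meet inside the ball. -/
def BallSeparates (X : SimpleGraph V) (P : V) (r : ℕ) (L R : Set V) : Prop :=
  ∀ ⦃x y⦄, x ∈ L → y ∈ R → ∀ w : X.Walk x y, ∃ z ∈ w.support, X.dist P z ≤ r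

namespace BallSeparates

theorem symm (h : BallSeparates X P r L R) : BallSeparates X P r R L := fun _ _ hx hy w => by
  simpa using h hy hx w.reverse

theorem dist_le (h : BallSeparates X P r L R) (hX : X.Connected) {x y : V} (hx : x ∈ L)
    (hy : y ∈ R) : X.dist P x ≤ r + X.dist x y := by
  obtain ⟨w, hw⟩ := hX.exists_walk_length_eq_dist x y
  obtain ⟨z, hz, hPz⟩ := h hx hy w
  have hxz := dist_add_dist_le_length w hz
  have htri := hX.dist_triangle (u := P) (v := z) (w := x)
  rw [SimpleGraph.dist_comm (u := z) (v := x)] at htri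
  omega

theorem dist_le_or_dist_le_of_adj (h : BallSeparates X P r L R) {x y : V} (hx : x ∈ L)
    (hy : y ∈ R) (hxy : X.Adj x y) : X.dist P x ≤ r ∨ X.dist P y ≤ r := by
  simpa using h hx hy hxy.toWalk

theorem forall_mem_or_forall_mem (h : BallSeparates X P r L R) (hLR : L ∪ R = Set.univ)
    {γ : ℤ → V} (hγ : ∀ m, X.Adj (γ m) (γ (m + 1))) (hfar : ∀ m, r < X.dist P (γ m)) :
    (∀ m, γ m ∈ L) ∨ ∀ m, γ m ∈ R := by
  have hcover (x : V) : x ∈ L ∨ x ∈ R := Set.eq_univ_iff_forall.mp hLR x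
  have hstay {m n : ℤ} (hmn : X.Adj (γ m) (γ n)) (hm : γ m ∈ R) : γ n ∈ R :=
    (hcover (γ n)).resolve_left fun hn =>
      (h.symm.dist_le_or_dist_le_of_adj hm hn hmn).elim (hfar m).not_ge (hfar n).not_ge
  have hiff (m : ℤ) : γ m ∈ R ↔ γ 0 ∈ R := by
    induction m with
    | zero => rfl
    | succ m ih =>
      exact ⟨fun hm => ih.mp (hstay (hγ m).symm hm), fun h0 => hstay (hγ m) (ih.mpr h0)⟩
    | pred m ih =>
      have hadj := hγ (-m - 1)
      rw [sub_add_cancel] at hadj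
      exact ⟨fun hm => ih.mp (hstay hadj hm), fun h0 => hstay hadj.symm (ih.mpr h0)⟩
  by_cases h0 : γ 0 ∈ R
  · exact Or.inr fun m => (hiff m).mpr h0
  · exact Or.inl fun m => (hcover (γ m)).resolve_right fun hm => h0 ((hiff m).mp hm)

theorem exists_dist_le_of_isGeodesicAxis (h : BallSeparates X P r L R) (hX : X.Connected)
    (hLR : L ∪ R = Set.univ) (hL : ∀ C, ∃ n : ℤ, (φ ^ n) P ∈ L ∧ C < X.dist P ((φ ^ n) P))
    (hR : ∀ C, ∃ n : ℤ, (φ ^ n) P ∈ R ∧ C < X.dist P ((φ ^ n) P)) {γ : ℤ → V}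
    (hγ : IsGeodesicAxis X φ P γ) : ∃ m, X.dist P (γ m) ≤ r := by
  by_contra! hfar
  obtain ⟨hgeod, C, hC, -⟩ := hγ
  have hadj (m : ℤ) : X.Adj (γ m) (γ (m + 1)) := by
    simp [← SimpleGraph.dist_eq_one_iff_adj, hgeod m (m + 1)]
  rcases h.forall_mem_or_forall_mem hLR hadj hfar with hside | hside
  · obtain ⟨n, hn, hfarn⟩ := hR (r + C)
    obtain ⟨m, hm⟩ := hC n
    have hnear := h.symm.dist_le hX hn (hside m)
    rw [SimpleGraph.dist_comm (u := (φ ^ n) P)] at hnear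
    omega
  · obtain ⟨n, hn, hfarn⟩ := hL (r + C)
    obtain ⟨m, hm⟩ := hC n
    have hnear := h.dist_le hX hn (hside m)
    rw [SimpleGraph.dist_comm (u := (φ ^ n) P)] at hnear
    omega

end BallSeparates

end Separation

section ReducedFractions

theorem isCoprime_num_den (x : OnePoint ℚ) : IsCoprime (num x) (den x) := by
  cases x with
  | infty => exact isCoprime_one_left
  | coe q => exact Rat.isCoprime_num_den q

/-- The vertex `p / q`, where `p / 0 = ∞`. -/
noncomputable def ratio (p q : ℤ) : OnePoint ℚ :=
  if q = 0 then OnePoint.infty else ((p / q : ℚ) : OnePoint ℚ)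

theorem ratio_num_den (x : OnePoint ℚ) : ratio (num x) (den x) = x := by
  cases x with
  | infty => rfl
  | coe r => simp [ratio, num, den, Rat.num_div_den]

theorem ratio_zero_one : ratio 0 1 = zeroVertex := ratio_num_den zeroVertex

theorem ratio_mul_mul {c : ℤ} (hc : c ≠ 0) (p q : ℤ) : ratio (c * p) (c * q) = ratio p q := by
  simp [ratio, hc, mul_div_mul_left]

theorem ratio_eq_ratio {p q r s : ℤ} (hpq : IsCoprime p q) (hrs : IsCoprime r s)
    (h : p * s = q * r) : ratio p q = ratio r s := by
  obtain ⟨u, v, huv⟩ := hpq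
  have hr : (u * r + v * s) * p = r := by linear_combination v * h + r * huv
  have hs : (u * r + v * s) * q = s := by linear_combination -u * h + s * huv
  have hc : u * r + v * s ≠ 0 := fun hc => hrs.ne_zero_or_ne_zero.elim
    (fun hr0 => hr0 (by rw [← hr, hc, zero_mul])) fun hs0 => hs0 (by rw [← hs, hc, zero_mul])
  rw [← ratio_mul_mul hc, hr, hs]

theorem eq_ratio_of_num_mul_eq {x : OnePoint ℚ} {p q : ℤ} (h : IsCoprime p q)
    (hx : num x * q = den x * p) : x = ratio p q := by
  rw [← ratio_eq_ratio (isCoprime_num_den x) h hx, ratio_num_den]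

theorem num_den_ratio_of_pos {p q : ℤ} (h : IsCoprime p q) (hq : 0 < q) :
    num (ratio p q) = p ∧ den (ratio p q) = q := by
  have hcoprime : Nat.Coprime p.natAbs q.natAbs := Int.isCoprime_iff_gcd_eq_one.mp h
  rw [ratio, if_neg hq.ne']
  exact ⟨Rat.num_div_eq_of_coprime hq hcoprime, Rat.den_div_eq_of_coprime hq hcoprime⟩

theorem num_den_ratio {p q : ℤ} (h : IsCoprime p q) :
    ∃ ε : ℤˣ, num (ratio p q) = ε * p ∧ den (ratio p q) = ε * q := by
  rcases lt_trichotomy q 0 with hq | rfl | hq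
  · have hneg := num_den_ratio_of_pos h.neg_neg (neg_pos.mpr hq)
    rw [neg_eq_neg_one_mul p, neg_eq_neg_one_mul q, ratio_mul_mul (by norm_num)] at hneg
    exact ⟨-1, by simpa using hneg⟩
  · obtain ⟨ε, rfl⟩ := isCoprime_zero_right.mp h
    exact ⟨ε, by simp [ratio, num, den, ← Units.val_mul]⟩
  · exact ⟨1, by simpa using num_den_ratio_of_pos h hq⟩

theorem num_ratio_sq {p q : ℤ} (h : IsCoprime p q) : num (ratio p q) ^ 2 = p ^ 2 := by
  obtain ⟨ε, hnum, -⟩ := num_den_ratio h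
  rw [hnum, mul_pow, ← Units.val_pow_eq_pow_val, Int.units_sq, Units.val_one, one_mul]

theorem den_ratio_mul_num_ratio {p q : ℤ} (h : IsCoprime p q) :
    den (ratio p q) * num (ratio p q) = q * p := by
  obtain ⟨ε, hnum, hden⟩ := num_den_ratio h
  rw [hnum, hden, mul_mul_mul_comm, ← Units.val_mul, Int.units_mul_self, Units.val_one, one_mul]

theorem num_ne_zero {x : OnePoint ℚ} (hx : x ≠ zeroVertex) : num x ≠ 0 := fun h =>
  hx <| (eq_ratio_of_num_mul_eq isCoprime_one_right (by simp [h])).trans ratio_zero_one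

end ReducedFractions

section FareyGraph

theorem fareyGraph_adj {x y : OnePoint ℚ} :
    fareyGraph.Adj x y ↔ |num x * den y - den x * num y| = 1 :=
  Iff.rfl

theorem ratio_adj_ratio {p q r s : ℤ} (hpq : IsCoprime p q) (hrs : IsCoprime r s) :
    fareyGraph.Adj (ratio p q) (ratio r s) ↔ |p * s - q * r| = 1 := by
  obtain ⟨ε, hp, hq⟩ := num_den_ratio hpq
  obtain ⟨δ, hr, hs⟩ := num_den_ratio hrs
  have hdet : (ε * p * (δ * s) - ε * q * (δ * r) : ℤ) = ε * (δ * (p * s - q * r)) := by ring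
  rw [fareyGraph_adj, hp, hq, hr, hs, hdet]
  simp only [abs_mul, ← Int.natCast_natAbs, Int.units_natAbs, Nat.cast_one, one_mul]

theorem slAction_apply (g : SL(2, ℤ)) (x : OnePoint ℚ) :
    slAction g x =
      ratio (g 0 0 * num x + g 0 1 * den x) (g 1 0 * num x + g 1 1 * den x) := by
  change Matrix.SpecialLinearGroup.mapGL ℚ g • x = _
  cases x with
  | infty => simp [OnePoint.smul_infty_eq_ite, ratio, num, den]
  | coe r =>
    have hden : (r.den : ℚ) ≠ 0 := mod_cast r.den_ne_zero
    have hrow (i : Fin 2) :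
        ((g i 0 * r.num + g i 1 * r.den : ℤ) : ℚ) = (g i 0 * r + g i 1) * r.den := by
      push_cast
      rw [add_mul, mul_assoc, Rat.mul_den_eq_num]
    have hpole : g 1 0 * r.num + g 1 1 * r.den = 0 ↔ (g 1 0 * r + g 1 1 : ℚ) = 0 := by
      rw [← @Int.cast_eq_zero ℚ, hrow, mul_eq_zero_iff_right hden]
    simp only [OnePoint.smul_some_eq_ite, ratio, num, den, OnePoint.elim_some, hpole, hrow]
    simp [mul_div_mul_right _ _ hden]

theorem det_eq_one (g : SL(2, ℤ)) : g 0 0 * g 1 1 - g 0 1 * g 1 0 = 1 := by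
  rw [← Matrix.det_fin_two, g.det_coe]

theorem isCoprime_slAction (g : SL(2, ℤ)) (x : OnePoint ℚ) :
    IsCoprime (g 0 0 * num x + g 0 1 * den x) (g 1 0 * num x + g 1 1 * den x) := by
  obtain ⟨u, v, h⟩ := isCoprime_num_den x
  refine ⟨u * g 1 1 - v * g 1 0, v * g 0 0 - u * g 0 1, ?_⟩
  linear_combination h * (g 0 0 * g 1 1 - g 0 1 * g 1 0) + det_eq_one g

theorem slAction_adj_slAction (g : SL(2, ℤ)) {x y : OnePoint ℚ} :
    fareyGraph.Adj (slAction g x) (slAction g y) ↔ fareyGraph.Adj x y := by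
  rw [slAction_apply, slAction_apply,
    ratio_adj_ratio (isCoprime_slAction g x) (isCoprime_slAction g y),
    fareyGraph_adj]
  congr! 2
  linear_combination (num x * den y - den x * num y) * det_eq_one g

theorem dist_slAction (g : SL(2, ℤ)) (x y : OnePoint ℚ) :
    fareyGraph.dist (slAction g x) (slAction g y) = fareyGraph.dist x y :=
  dist_iso_apply (⟨slAction g, slAction_adj_slAction g⟩ : fareyGraph ≃g fareyGraph) x y

theorem den_pos {x : OnePoint ℚ} (hx : x ≠ OnePoint.infty) : 0 < den x := by
  cases x with
  | infty => exact absurd rfl hx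
  | coe r => exact Int.natCast_pos.mpr r.den_pos

theorem exists_adj_natAbs_den_lt {x : OnePoint ℚ} (hx : x ≠ OnePoint.infty) :
    ∃ y, fareyGraph.Adj x y ∧ (den y).natAbs < (den x).natAbs := by
  have hpos := den_pos hx
  obtain ⟨u, v, huv⟩ := isCoprime_num_den x
  obtain ⟨r, s, hs0, hs, hrs⟩ : ∃ r s : ℤ, 0 ≤ s ∧ s < den x ∧ num x * s - den x * r = 1 :=
    ⟨-v - num x * (u / den x), u % den x, Int.emod_nonneg _ hpos.ne', Int.emod_lt_of_pos _ hpos,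
      by linear_combination huv + num x * Int.emod_add_mul_ediv u (den x)⟩
  have hcoprime : IsCoprime r s := ⟨-den x, num x, by linear_combination hrs⟩
  refine ⟨ratio r s, ?_, ?_⟩
  · rw [← ratio_num_den x, ratio_adj_ratio (isCoprime_num_den x) hcoprime, hrs, abs_one]
  · obtain ⟨ε, -, hden⟩ := num_den_ratio hcoprime
    rw [hden, Int.natAbs_mul, Int.units_natAbs]
    omega

theorem fareyGraph_reachable_infty (x : OnePoint ℚ) : fareyGraph.Reachable x OnePoint.infty := by
  induction h : (den x).natAbs using Nat.strong_induction_on generalizing x with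
  | _ n ih =>
    by_cases hx : x = OnePoint.infty
    · rw [hx]
    · obtain ⟨y, hxy, hlt⟩ := exists_adj_natAbs_den_lt hx
      exact hxy.reachable.trans (ih _ (h ▸ hlt) y rfl)

theorem fareyGraph_connected : fareyGraph.Connected where
  preconnected x y := (fareyGraph_reachable_infty x).trans (fareyGraph_reachable_infty y).symm
  nonempty := ⟨OnePoint.infty⟩

end FareyGraph

section Arcs

/-- The vertices `x` with `1 / x ≤ k`, together with `0`, the point at infinity of the coordinate
`1 / x`. Multiplying by `num x ^ 2` removes the case distinction at `x = 0`. -/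
def lowerArc (k : ℤ) : Set (OnePoint ℚ) := {x | den x * num x ≤ k * num x ^ 2}

/-- The vertices `x` with `k ≤ 1 / x`, together with `0`, the point at infinity of the coordinate
`1 / x`. -/
def upperArc (k : ℤ) : Set (OnePoint ℚ) := {x | k * num x ^ 2 ≤ den x * num x}

theorem mem_lowerArc {k : ℤ} {x : OnePoint ℚ} : x ∈ lowerArc k ↔ den x * num x ≤ k * num x ^ 2 :=
  Iff.rfl

theorem mem_upperArc {k : ℤ} {x : OnePoint ℚ} : x ∈ upperArc k ↔ k * num x ^ 2 ≤ den x * num x :=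
  Iff.rfl

theorem ratio_mem_lowerArc {p q k : ℤ} (h : IsCoprime p q) :
    ratio p q ∈ lowerArc k ↔ q * p ≤ k * p ^ 2 := by
  rw [mem_lowerArc, num_ratio_sq h, den_ratio_mul_num_ratio h]

theorem ratio_mem_upperArc {p q k : ℤ} (h : IsCoprime p q) :
    ratio p q ∈ upperArc k ↔ k * p ^ 2 ≤ q * p := by
  rw [mem_upperArc, num_ratio_sq h, den_ratio_mul_num_ratio h]

theorem zeroVertex_mem_lowerArc (k : ℤ) : zeroVertex ∈ lowerArc k := by
  simp [lowerArc, zeroVertex, num]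

theorem zeroVertex_mem_upperArc (k : ℤ) : zeroVertex ∈ upperArc k := by
  simp [upperArc, zeroVertex, num]

theorem lowerArc_union_upperArc (k : ℤ) : lowerArc k ∪ upperArc k = Set.univ :=
  Set.eq_univ_of_forall fun x => le_total (den x * num x) (k * num x ^ 2)

theorem upperArc_antitone : Antitone upperArc := fun _ _ hjk _ hx =>
  (mul_le_mul_of_nonneg_right hjk (sq_nonneg _)).trans hx

theorem eq_zeroVertex_of_mem_lowerArc_of_mem_upperArc {j k : ℤ} (hjk : j < k) {x : OnePoint ℚ}
    (hj : x ∈ lowerArc j) (hk : x ∈ upperArc k) : x = zeroVertex := by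
  by_contra hx
  have hlt := mul_lt_mul_of_pos_right hjk (pow_two_pos_of_ne_zero (num_ne_zero hx))
  exact hlt.not_ge (le_trans hk hj)

theorem abs_add_ne_one_of_mul_pos {a b : ℤ} (h : 0 < a * b) : |a + b| ≠ 1 := by
  rcases mul_pos_iff.mp h with h | h
  · rw [abs_of_pos] <;> omega
  · rw [abs_of_neg] <;> omega

theorem eq_ratio_one_of_adj_of_notMem_lowerArc {k : ℤ} {x y : OnePoint ℚ} (hx : x ∈ lowerArc k)
    (hx0 : x ≠ zeroVertex) (hy : y ∉ lowerArc k) (hxy : fareyGraph.Adj x y) : x = ratio 1 k := by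
  by_contra hne
  rw [mem_lowerArc] at hx
  rw [mem_lowerArc, not_le] at hy
  have hden : k * num x - den x ≠ 0 := fun h =>
    hne (eq_ratio_of_num_mul_eq isCoprime_one_left (by linear_combination h))
  have hleft : 0 < (k * num x - den x) * num x :=
    lt_of_le_of_ne (by linear_combination hx) (mul_ne_zero hden (num_ne_zero hx0)).symm
  have hright : 0 < (den y - k * num y) * num y := by linear_combination hy
  refine abs_add_ne_one_of_mul_pos (a := (k * num x - den x) * num y)
    (b := (den y - k * num y) * num x) ?_ ?_
  · linear_combination mul_pos hleft hright
  · rw [← fareyGraph_adj.mp hxy]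
    ring_nf

theorem zeroVertex_mem_support_or_ratio_one_mem_support {k : ℤ} {x y : OnePoint ℚ}
    (hx : x ∈ lowerArc k) (hy : y ∈ upperArc k) (w : fareyGraph.Walk x y) :
    zeroVertex ∈ w.support ∨ ratio 1 k ∈ w.support := by
  by_cases hyk : y ∈ lowerArc k
  · by_cases hy0 : y = zeroVertex
    · exact Or.inl (hy0 ▸ w.end_mem_support)
    · have hden : den y = k * num y := mul_right_cancel₀ (num_ne_zero hy0) <| by
        linear_combination le_antisymm (mem_lowerArc.mp hyk) (mem_upperArc.mp hy)
      have hy1 : y = ratio 1 k :=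
        eq_ratio_of_num_mul_eq isCoprime_one_left (by rw [hden]; ring)
      exact Or.inr (hy1 ▸ w.end_mem_support)
  · obtain ⟨d, hd, hfst, hsnd⟩ := w.exists_boundary_dart (lowerArc k) hx hyk
    have hmem := w.dart_fst_mem_support_of_mem_darts hd
    by_cases h0 : d.fst = zeroVertex
    · exact Or.inl (h0 ▸ hmem)
    · exact Or.inr (eq_ratio_one_of_adj_of_notMem_lowerArc hfst h0 hsnd d.adj ▸ hmem)

theorem zeroVertex_adj_ratio_one (k : ℤ) : fareyGraph.Adj zeroVertex (ratio 1 k) := by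
  rw [← ratio_zero_one, ratio_adj_ratio isCoprime_one_right isCoprime_one_left]
  norm_num

theorem ballSeparates_lowerArc_upperArc (k : ℤ) :
    BallSeparates fareyGraph zeroVertex 1 (lowerArc k) (upperArc k) := fun x y hx hy w => by
  rcases zeroVertex_mem_support_or_ratio_one_mem_support hx hy w with h | h
  · exact ⟨zeroVertex, h, by simp⟩
  · exact ⟨ratio 1 k, h, (SimpleGraph.dist_eq_one_iff_adj.mpr (zeroVertex_adj_ratio_one k)).le⟩

theorem dist_add_dist_eq_zeroVertex_or_ratio_one {k : ℤ} {x y : OnePoint ℚ} (hx : x ∈ lowerArc k)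
    (hy : y ∈ upperArc k) : ∃ z, (z = zeroVertex ∨ z = ratio 1 k) ∧
      fareyGraph.dist x z + fareyGraph.dist z y = fareyGraph.dist x y := by
  obtain ⟨w, hw⟩ := fareyGraph_connected.exists_walk_length_eq_dist x y
  have hthrough {z : OnePoint ℚ} (hz : z ∈ w.support) :
      fareyGraph.dist x z + fareyGraph.dist z y = fareyGraph.dist x y :=
    ((dist_add_dist_le_length w hz).trans hw.le).antisymm fareyGraph_connected.dist_triangle
  rcases zeroVertex_mem_support_or_ratio_one_mem_support hx hy w with h | h
  · exact ⟨zeroVertex, Or.inl rfl, hthrough h⟩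
  · exact ⟨ratio 1 k, Or.inr rfl, hthrough h⟩

theorem ratio_one_ne_ratio_one {j k : ℤ} (hjk : j < k) : ratio 1 j ≠ ratio 1 k := fun h =>
  (zeroVertex_adj_ratio_one j).ne' <| eq_zeroVertex_of_mem_lowerArc_of_mem_upperArc hjk
    ((ratio_mem_lowerArc isCoprime_one_left).mpr (by simp))
    (h ▸ (ratio_mem_upperArc isCoprime_one_left).mpr (by simp))

theorem two_le_dist_ratio_one {j k : ℤ} (hjk : j + 2 ≤ k) :
    2 ≤ fareyGraph.dist (ratio 1 j) (ratio 1 k) := by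
  refine fareyGraph_connected.one_lt_dist_of_ne_of_not_adj
    (ratio_one_ne_ratio_one (by omega)) fun h => ?_
  rw [ratio_adj_ratio isCoprime_one_left isCoprime_one_left, one_mul, mul_one, abs_eq] at h <;>
    omega

theorem dist_eq_dist_zeroVertex_add {j k : ℤ} (hjk : j + 2 ≤ k) {x y : OnePoint ℚ}
    (hx : x ∈ lowerArc j) (hy : y ∈ upperArc k) :
    fareyGraph.dist x y = fareyGraph.dist x zeroVertex + fareyGraph.dist zeroVertex y := by
  have hconn := fareyGraph_connected
  have hjk' : j ≤ k := by omega
  obtain ⟨_, rfl | rfl, hxy⟩ :=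
    dist_add_dist_eq_zeroVertex_or_ratio_one hx (upperArc_antitone hjk' hy)
  · exact hxy.symm
  have hj : ratio 1 j ∈ lowerArc k := (ratio_mem_lowerArc isCoprime_one_left).mpr (by simpa)
  have hxj := hconn.dist_triangle (u := x) (v := ratio 1 j) (w := zeroVertex)
  refine hconn.dist_triangle.antisymm ?_
  obtain ⟨_, rfl | rfl, hjy⟩ := dist_add_dist_eq_zeroVertex_or_ratio_one hj hy
  · omega
  · have hjk_dist := two_le_dist_ratio_one hjk
    have hj0 := SimpleGraph.dist_eq_one_iff_adj.mpr (zeroVertex_adj_ratio_one j).symm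
    have hk0 := SimpleGraph.dist_eq_one_iff_adj.mpr (zeroVertex_adj_ratio_one k)
    have hky := hconn.dist_triangle (u := zeroVertex) (v := ratio 1 k) (w := y)
    omega

end Arcs

section Contracting

/-- A permutation of `ℚ ∪ {∞}` that maps `[0, ∞]` into `(0, 1 / 2]`. Such Farey isometries are the
loxodromic elements that the counting argument produces. -/
def IsContracting (φ : Equiv.Perm (OnePoint ℚ)) : Prop :=
  Set.MapsTo φ (upperArc 0) (upperArc 2 \ {zeroVertex})

namespace IsContracting

variable {φ : Equiv.Perm (OnePoint ℚ)}

theorem mapsTo_inv (h : IsContracting φ) : Set.MapsTo ⇑φ⁻¹ (lowerArc 0) (lowerArc 0) := by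
  intro x hx
  by_contra hx'
  have hpre : φ⁻¹ x ∈ upperArc 0 :=
    (Set.eq_univ_iff_forall.mp (lowerArc_union_upperArc 0) _).resolve_left hx'
  have himage : x ∈ upperArc 2 \ {zeroVertex} := by simpa using h hpre
  exact himage.2 (eq_zeroVertex_of_mem_lowerArc_of_mem_upperArc two_pos hx himage.1)

theorem apply_zeroVertex_mem (h : IsContracting φ) : φ zeroVertex ∈ upperArc 2 \ {zeroVertex} :=
  h (zeroVertex_mem_upperArc 0)

theorem pow_zeroVertex_mem_upperArc (h : IsContracting φ) (n : ℕ) :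
    (φ ^ n) zeroVertex ∈ upperArc 0 := by
  rw [Equiv.Perm.coe_pow]
  exact h.mono_right (Set.sdiff_subset.trans (upperArc_antitone two_pos.le)) |>.iterate n
    (zeroVertex_mem_upperArc 0)

theorem inv_pow_zeroVertex_mem_lowerArc (h : IsContracting φ) (n : ℕ) :
    (φ⁻¹ ^ n) zeroVertex ∈ lowerArc 0 := by
  rw [Equiv.Perm.coe_pow]
  exact h.mapsTo_inv.iterate n (zeroVertex_mem_lowerArc 0)

theorem dist_pos (h : IsContracting φ) : 0 < fareyGraph.dist zeroVertex (φ zeroVertex) :=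
  fareyGraph_connected.pos_dist_of_ne fun h0 => h.apply_zeroVertex_mem.2 h0.symm

theorem hasAlignedOrbit (h : IsContracting φ)
    (hφ : ∀ x y, fareyGraph.dist (φ x) (φ y) = fareyGraph.dist x y) :
    HasAlignedOrbit fareyGraph φ zeroVertex :=
  hasAlignedOrbit_of_dist_eq_add hφ fun n =>
    dist_eq_dist_zeroVertex_add (zero_add 2).le (h.inv_pow_zeroVertex_mem_lowerArc n)
      h.apply_zeroVertex_mem.1

theorem actsLoxodromically (h : IsContracting φ)
    (hφ : ∀ x y, fareyGraph.dist (φ x) (φ y) = fareyGraph.dist x y) :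
    ActsLoxodromically fareyGraph φ zeroVertex :=
  (h.hasAlignedOrbit hφ).actsLoxodromically h.dist_pos

theorem lt_dist_zpow (h : IsContracting φ)
    (hφ : ∀ x y, fareyGraph.dist (φ x) (φ y) = fareyGraph.dist x y) {C : ℕ} {n : ℤ}
    (hn : C < n.natAbs) :
    C < fareyGraph.dist zeroVertex ((φ ^ n) zeroVertex) := by
  have hdist := (h.hasAlignedOrbit hφ).dist_zpow_zpow hφ 0 n
  rw [zpow_zero, Equiv.Perm.one_apply, zero_sub, Int.natAbs_neg] at hdist
  exact hdist ▸ hn.trans_le (Nat.le_mul_of_pos_right _ h.dist_pos)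

theorem axisPassesWithin (h : IsContracting φ)
    (hφ : ∀ x y, fareyGraph.dist (φ x) (φ y) = fareyGraph.dist x y) :
    AxisPassesWithin fareyGraph φ zeroVertex 1 := by
  refine ⟨(h.hasAlignedOrbit hφ).exists_isGeodesicAxis_translatesLine fareyGraph_connected hφ
    h.dist_pos, fun γ => (ballSeparates_lowerArc_upperArc 0).exists_dist_le_of_isGeodesicAxis
    fareyGraph_connected (lowerArc_union_upperArc 0) (fun C => ⟨-(C + 1 : ℕ), ?_, ?_⟩)
    fun C => ⟨(C + 1 : ℕ), ?_, ?_⟩⟩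
  · rw [zpow_neg, zpow_natCast, ← inv_pow]
    exact h.inv_pow_zeroVertex_mem_lowerArc _
  · exact h.lt_dist_zpow hφ (by omega)
  · exact h.pow_zeroVertex_mem_upperArc _
  · exact h.lt_dist_zpow hφ (by omega)

end IsContracting

end Contracting

section Matrices

theorem mul_apply_two (g h : SL(2, ℤ)) (i j : Fin 2) :
    (g * h) i j = g i 0 * h 0 j + g i 1 * h 1 j := by
  rw [Matrix.SpecialLinearGroup.coe_mul, Matrix.mul_apply, Fin.sum_univ_two]

theorem slAction_neg (g : SL(2, ℤ)) : slAction (-g) = slAction g := by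
  have hcenter : (-1 : SL(2, ℤ)) ∈ Subgroup.center SL(2, ℤ) := by
    simp [Subgroup.mem_center_iff]
  rw [← neg_one_mul, map_mul, slAction_eq_one_of_mem_center _ hcenter, one_mul]

theorem mapsTo_slAction_upperArc {g : SL(2, ℤ)} {k : ℤ} (h00 : 0 < g 0 0) (h01 : 0 < g 0 1)
    (h10 : k * g 0 0 ≤ g 1 0) (h11 : k * g 0 1 ≤ g 1 1) :
    Set.MapsTo (slAction g) (upperArc 0) (upperArc k \ {zeroVertex}) := by
  intro x hx
  rw [mem_upperArc, zero_mul] at hx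
  have hcoprime := isCoprime_slAction g x
  rw [slAction_apply]
  refine ⟨(ratio_mem_upperArc hcoprime).mpr ?_, fun h0 => ?_⟩
  · have hp := mul_nonneg (mul_nonneg (sub_nonneg.mpr h10) h00.le) (sq_nonneg (num x))
    have hq := mul_nonneg (mul_nonneg (sub_nonneg.mpr h11) h01.le) (sq_nonneg (den x))
    have hpq := mul_nonneg (add_nonneg (mul_nonneg (sub_nonneg.mpr h10) h01.le)
      (mul_nonneg (sub_nonneg.mpr h11) h00.le)) hx
    linear_combination hp + hq + hpq
  · have hnum : g 0 0 * num x + g 0 1 * den x = 0 := by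
      rw [← sq_eq_zero_iff, ← num_ratio_sq hcoprime, h0]
      rfl
    refine lt_irrefl (0 : ℤ) ?_
    rcases (isCoprime_num_den x).ne_zero_or_ne_zero with hp | hq
    · linear_combination
        mul_pos h00 (pow_two_pos_of_ne_zero hp) + mul_nonneg h01.le hx + num x * hnum
    · linear_combination
        mul_pos h01 (pow_two_pos_of_ne_zero hq) + mul_nonneg h00.le hx + den x * hnum

/-- All entries of the matrix have the same weak sign, so that its class in `PSL(2, ℤ)` has a
representative with nonnegative entries. -/
def EntriesHaveSameSign (m : SL(2, ℤ)) : Prop :=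
  (∀ i j, 0 ≤ m i j) ∨ ∀ i j, m i j ≤ 0

theorem exists_entriesHaveSameSign_mul_mul (g : SL(2, ℤ)) :
    ∃ u ∈ ({1, ModularGroup.S} : Set SL(2, ℤ)), ∃ v ∈ ({1, ModularGroup.S} : Set SL(2, ℤ)),
      EntriesHaveSameSign (u * g * v) := by
  have hdet := det_eq_one g
  have hsigns : 0 ≤ g 0 0 * g 1 1 ∧ 0 ≤ g 0 1 * g 1 0 ∨ g 0 0 * g 1 1 ≤ 0 ∧ g 0 1 * g 1 0 ≤ 0 := by
    omega
  simp only [mul_nonneg_iff, mul_nonpos_iff] at hsigns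
  simp only [Set.mem_insert_iff, Set.mem_singleton_iff, exists_eq_or_imp, exists_eq_left,
    EntriesHaveSameSign, Fin.forall_fin_two, mul_apply_two, ModularGroup.coe_S]
  simp only [Fin.isValue, Matrix.SpecialLinearGroup.coe_one, Matrix.one_apply_eq, one_mul, ne_eq,
    zero_ne_one, not_false_eq_true, Matrix.one_apply_ne, zero_mul, add_zero, mul_one, one_ne_zero,
    mul_zero, zero_add, Int.reduceNeg, Matrix.of_apply, Matrix.cons_val', Matrix.cons_val_zero,
    Matrix.cons_val_fin_one, Matrix.cons_val_one, mul_neg, Int.neg_nonneg, Left.neg_nonpos_iff,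
    neg_mul, neg_neg]
  omega

theorem coe_matA_inv : (↑matA⁻¹ : Matrix (Fin 2) (Fin 2) ℤ) = !![1, -1; 0, 1] := by
  rw [Matrix.SpecialLinearGroup.coe_inv, Matrix.adjugate_fin_two]
  simp [matA]

theorem coe_matB_inv : (↑matB⁻¹ : Matrix (Fin 2) (Fin 2) ℤ) = !![1, 0; 1, 1] := by
  rw [Matrix.SpecialLinearGroup.coe_inv, Matrix.adjugate_fin_two]
  simp [matB]

theorem isContracting_slAction_of_nonneg {m : SL(2, ℤ)} (hm : ∀ i j, 0 ≤ m i j) :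
    IsContracting (slAction (matB⁻¹ * matB⁻¹ * m * matA)) := by
  have hpos : 0 < m 0 0 := (hm 0 0).lt_of_ne fun h => by
    have hdet := det_eq_one m
    rw [← h] at hdet
    linarith [mul_nonneg (hm 0 1) (hm 1 0)]
  have h01 := hm 0 1
  have h10 := hm 1 0
  have h11 := hm 1 1
  have hA : (matA : Matrix (Fin 2) (Fin 2) ℤ) = !![1, 1; 0, 1] := rfl
  apply mapsTo_slAction_upperArc <;>
    simp only [mul_apply_two, coe_matB_inv, hA, Matrix.of_apply, Matrix.cons_val',
      Matrix.cons_val_zero, Matrix.cons_val_one, Matrix.cons_val_fin_one] <;>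
    omega

theorem isContracting_slAction_of_entriesHaveSameSign {m : SL(2, ℤ)} (hm : EntriesHaveSameSign m) :
    IsContracting (slAction (matB⁻¹ * matB⁻¹ * m * matA)) := by
  rcases hm with hm | hm
  · exact isContracting_slAction_of_nonneg hm
  · rw [← slAction_neg, ← neg_mul, ← mul_neg]
    exact isContracting_slAction_of_nonneg fun i j => by simpa using hm i j

theorem modularGroup_S_eq : ModularGroup.S = matA⁻¹ * matB⁻¹ * matA⁻¹ := by
  apply Subtype.ext
  rw [Matrix.SpecialLinearGroup.coe_mul, Matrix.SpecialLinearGroup.coe_mul, coe_matA_inv,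
    coe_matB_inv, ModularGroup.coe_S]
  simp

end Matrices

section Counting

open scoped Pointwise

theorem liminf_natCast_div_pos {ι : Type*} {f : Filter ι} [f.NeBot] {a b : ι → ℕ} {K : ℕ}
    (hb : ∀ᶠ i in f, 0 < b i) (hab : ∀ᶠ i in f, a i ≤ b i) (hba : ∀ᶠ i in f, b i ≤ K * a i) :
    0 < liminf (fun i => (a i : ℝ) / b i) f := by
  obtain ⟨i, hi, hi'⟩ := (hb.and hba).exists
  have hK : 0 < K := Nat.pos_of_mul_pos_right (hi.trans_le hi')
  refine (inv_pos.mpr (Nat.cast_pos.mpr hK)).trans_le (le_liminf_of_le ?_ ?_)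
  · exact IsCoboundedUnder.of_frequently_le (a := 1)
      (hab.mono fun i hi => div_le_one_of_le₀ (mod_cast hi) (Nat.cast_nonneg _)).frequently
  · filter_upwards [hb, hba] with i hi hi'
    rw [inv_eq_one_div, div_le_div_iff₀ (mod_cast hK) (mod_cast hi), one_mul, mul_comm]
    exact_mod_cast hi'

variable {G : Type*} [Group G]

theorem finite_pow {M : Type*} [Monoid M] {S : Set M} (hS : S.Finite) (n : ℕ) :
    (S ^ n).Finite := by
  induction n with
  | zero => simp
  | succ n ih => exact pow_succ S n ▸ ih.mul hS

theorem ncard_pow_le_mul_ncard_pow_inter {S T : Set G} {i j : ℕ} (hS : S.Finite)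
    (hT : ∀ g, ∃ u ∈ S ^ i, ∃ v ∈ S ^ j, u * g * v ∈ T) (m : ℕ) :
    (S ^ m).ncard ≤ (S ^ i).ncard * (S ^ (i + m + j) ∩ T).ncard * (S ^ j).ncard := by
  have hsub : S ^ m ⊆ (S ^ i)⁻¹ * (S ^ (i + m + j) ∩ T) * (S ^ j)⁻¹ := fun g hg => by
    obtain ⟨u, hu, v, hv, huv⟩ := hT g
    have hmem : u * g * v ∈ S ^ (i + m + j) := by
      rw [pow_add, pow_add]
      exact Set.mul_mem_mul (Set.mul_mem_mul hu hg) hv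
    exact ⟨u⁻¹ * (u * g * v), ⟨u⁻¹, Set.inv_mem_inv.mpr hu, _, ⟨hmem, huv⟩, rfl⟩, v⁻¹,
      Set.inv_mem_inv.mpr hv, by group⟩
  have hfin : ((S ^ i)⁻¹ * (S ^ (i + m + j) ∩ T) * (S ^ j)⁻¹).Finite :=
    ((finite_pow hS i).inv.mul ((finite_pow hS _).inter_of_left T)).mul (finite_pow hS j).inv
  calc (S ^ m).ncard
      ≤ ((S ^ i)⁻¹ * (S ^ (i + m + j) ∩ T) * (S ^ j)⁻¹).ncard := Set.ncard_le_ncard hsub hfin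
    _ ≤ ((S ^ i)⁻¹ * (S ^ (i + m + j) ∩ T)).ncard * (S ^ j)⁻¹.ncard := Set.natCard_mul_le
    _ ≤ (S ^ i)⁻¹.ncard * (S ^ (i + m + j) ∩ T).ncard * (S ^ j)⁻¹.ncard :=
        Nat.mul_le_mul_right _ (Set.natCard_mul_le)
    _ = (S ^ i).ncard * (S ^ (i + m + j) ∩ T).ncard * (S ^ j).ncard := by
        rw [Set.ncard_inv, Set.ncard_inv]

theorem liminf_ncard_pow_inter_div_pos {S T : Set G} (hS : S.Finite) (h1 : 1 ∈ S) (i j : ℕ)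
    (hT : ∀ g, ∃ u ∈ S ^ i, ∃ v ∈ S ^ j, u * g * v ∈ T) :
    0 < liminf (fun l : ℕ => ((S ^ l ∩ T).ncard : ℝ) / ((S ^ l).ncard : ℝ)) atTop := by
  refine liminf_natCast_div_pos
    (K := (S ^ i).ncard * (S ^ i).ncard * ((S ^ j).ncard * (S ^ j).ncard))
    (.of_forall fun l => (Set.ncard_pos (finite_pow hS l)).mpr ⟨1, Set.one_mem_pow h1⟩)
    (.of_forall fun l => Set.ncard_le_ncard Set.inter_subset_left (finite_pow hS l)) ?_
  filter_upwards [eventually_ge_atTop (i + j)] with l hl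
  obtain ⟨m, rfl⟩ : ∃ m, l = i + m + j := ⟨l - (i + j), by omega⟩
  have hm := ncard_pow_le_mul_ncard_pow_inter hS hT m
  calc (S ^ (i + m + j)).ncard
      ≤ (S ^ i).ncard * (S ^ m).ncard * (S ^ j).ncard := by
        rw [pow_add, pow_add]
        exact (Set.natCard_mul_le).trans (Nat.mul_le_mul_right _ (Set.natCard_mul_le))
    _ ≤ (S ^ i).ncard * ((S ^ i).ncard * (S ^ (i + m + j) ∩ T).ncard * (S ^ j).ncard) *
        (S ^ j).ncard := by gcongr
    _ = _ := by ring

theorem inv_mul_mem_pow_length {S : Set G} {x y : G} (w : (SimpleGraph.mulCayley S).Walk x y) :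
    x⁻¹ * y ∈ (insert 1 (S ∪ S⁻¹)) ^ w.length := by
  induction w with
  | nil => simp
  | @cons x z y h w ih =>
    rw [SimpleGraph.Walk.length_cons, pow_succ', show x⁻¹ * y = x⁻¹ * z * (z⁻¹ * y) by group]
    refine Set.mul_mem_mul (Set.mem_insert_of_mem _ ?_) ih
    obtain ⟨-, s, hs, rfl | rfl⟩ := (SimpleGraph.mulCayley_adj' _ _ _).mp h
    · exact Or.inl (by simpa)
    · exact Or.inr (by simpa)

theorem edist_mulCayley_mul_right_le_one {S : Set G} (x : G) {s : G}
    (hs : s ∈ insert 1 (S ∪ S⁻¹)) : (SimpleGraph.mulCayley S).edist x (x * s) ≤ 1 := by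
  rw [SimpleGraph.edist_le_one_iff_adj_or_eq, or_iff_not_imp_right, SimpleGraph.mulCayley_adj']
  intro hne
  refine ⟨hne, ?_⟩
  rcases hs with rfl | hs | hs
  · simp at hne
  · exact ⟨s, hs, Or.inl rfl⟩
  · exact ⟨s⁻¹, hs, Or.inr (by simp)⟩

theorem setOf_edist_mulCayley_one_le (S : Set G) (l : ℕ) :
    {g | (SimpleGraph.mulCayley S).edist 1 g ≤ l} = (insert 1 (S ∪ S⁻¹)) ^ l := by
  refine Set.Subset.antisymm (fun g hg => ?_) ?_
  · obtain ⟨w, hw⟩ := SimpleGraph.exists_walk_of_edist_ne_top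
      (ne_top_of_le_ne_top (ENat.natCast_ne_top l) hg)
    have hlen : w.length ≤ l := by
      rw [← Nat.cast_le (α := ℕ∞), hw]
      exact hg
    simpa using Set.pow_subset_pow_right (Set.mem_insert 1 _) hlen (inv_mul_mem_pow_length w)
  · induction l with
    | zero => simp
    | succ l ih =>
      rw [pow_succ]
      rintro _ ⟨x, hx, s, hs, rfl⟩
      exact SimpleGraph.edist_triangle.trans
        (add_le_add (ih hx) (edist_mulCayley_mul_right_le_one x hs))

end Counting

section PSL

open scoped Pointwise

/-- The standard generators `A^{±1}`, `B^{±1}` together with `1`; the `l`-th power of this set is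
the ball of radius `l`. -/
def generatorsWithOne : Set PSL(2, ℤ) := {1, A, A⁻¹, B, B⁻¹}

theorem finite_generatorsWithOne : generatorsWithOne.Finite := by simp [generatorsWithOne]

theorem one_mem_generatorsWithOne : 1 ∈ generatorsWithOne := Set.mem_insert 1 _

theorem cayleyBall_eq_pow (l : ℕ) : cayleyBall l = generatorsWithOne ^ l := by
  have hsymm : ({A, A⁻¹, B, B⁻¹} : Set PSL(2, ℤ))⁻¹ = {A, A⁻¹, B, B⁻¹} := by
    ext g
    simp only [Set.mem_inv, Set.mem_insert_iff, Set.mem_singleton_iff, inv_eq_iff_eq_inv, inv_inv]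
    tauto
  rw [cayleyBall, setOf_edist_mulCayley_one_le, hsymm, Set.union_self, generatorsWithOne]

theorem mk_mem_generatorsWithOne_pow_three {u : SL(2, ℤ)}
    (hu : u ∈ ({1, ModularGroup.S} : Set SL(2, ℤ))) :
    (QuotientGroup.mk u : PSL(2, ℤ)) ∈ generatorsWithOne ^ 3 := by
  rcases hu with rfl | rfl
  · exact Set.one_mem_pow one_mem_generatorsWithOne
  · have hA : A⁻¹ ∈ generatorsWithOne := by simp [generatorsWithOne]
    have hB : B⁻¹ ∈ generatorsWithOne := by simp [generatorsWithOne]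
    rw [modularGroup_S_eq, pow_succ, pow_two]
    exact Set.mul_mem_mul (Set.mul_mem_mul hA hB) hA

theorem exists_isContracting_mul_mul (g : PSL(2, ℤ)) :
    ∃ u ∈ generatorsWithOne ^ 5, ∃ v ∈ generatorsWithOne ^ 4,
      IsContracting (pslAction (u * g * v)) := by
  obtain ⟨g, rfl⟩ := QuotientGroup.mk_surjective g
  obtain ⟨u, hu, v, hv, huv⟩ := exists_entriesHaveSameSign_mul_mul g
  have hA : A ∈ generatorsWithOne := by simp [generatorsWithOne]
  have hB : B⁻¹ ∈ generatorsWithOne := by simp [generatorsWithOne]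
  refine ⟨B⁻¹ * B⁻¹ * QuotientGroup.mk u, ?_, QuotientGroup.mk v * A, ?_, ?_⟩
  · rw [pow_add _ 2 3, pow_two]
    exact Set.mul_mem_mul (Set.mul_mem_mul hB hB) (mk_mem_generatorsWithOne_pow_three hu)
  · rw [pow_succ]
    exact Set.mul_mem_mul (mk_mem_generatorsWithOne_pow_three hv) hA
  · have h := isContracting_slAction_of_entriesHaveSameSign huv
    rw [← mul_assoc, ← mul_assoc] at h
    convert h using 1
    simp only [mul_assoc]
    rfl

theorem dist_pslAction (g : PSL(2, ℤ)) (x y : OnePoint ℚ) :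
    fareyGraph.dist (pslAction g x) (pslAction g y) = fareyGraph.dist x y := by
  obtain ⟨g, rfl⟩ := QuotientGroup.mk_surjective g
  exact dist_slAction g x y

end PSL

end FareyPSL

theorem mainTheorem7 :
    0 < Filter.liminf
      (fun l : ℕ => ((FareyPSL.loxodromicInBall l).ncard : ℝ) /
        ((FareyPSL.cayleyBall l).ncard : ℝ)) Filter.atTop := by
  simp only [FareyPSL.loxodromicInBall, ← Set.inter_ofPred_eq_sep, FareyPSL.cayleyBall_eq_pow]
  refine FareyPSL.liminf_ncard_pow_inter_div_pos FareyPSL.finite_generatorsWithOne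
    FareyPSL.one_mem_generatorsWithOne 5 4 fun g => ?_
  obtain ⟨u, hu, v, hv, hcontracting⟩ := FareyPSL.exists_isContracting_mul_mul g
  have hisom := FareyPSL.dist_pslAction (u * g * v)
  exact ⟨u, hu, v, hv, hcontracting.actsLoxodromically hisom, hcontracting.axisPassesWithin hisom⟩
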